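/- Let $\tau$ be a (transverse) veering triangulation, with finitely many tetrahedra, of a connected oriented $3$-manifold $M$: a taut ideal triangulation (faces are cooriented, each tetrahedron has two top and two bottom faces, its top and bottom edges have angle $\pi$ and its other edges angle $0$, and angles sum to $2\pi$ around each edge) whose edges are labelled right or left veering, each tetrahedron being orientation-preservingly isomorphic to the model veering tetrahedron. Let $G=H_1(M;\mathbb Z)/\text{torsion}$, and let $E$ be the set of edges of $\tau$. For each tetrahedron $t$ let $\mathbf b$ be its bottom edge, $\mathbf t$ its top edge, and $\mathbf s_1,\mathbf s_2$ the two side edges whose veer is opposite to that of $\mathbf t$. Veering polynomial. Let $\widetilde M\to M$ be the universal free abelian cover, with deck group $G$, let $\widetilde\tau$ be the lifted triangulation, and choose a lift of each edge of $\tau$, which identifies the free $\mathbb Z$-module on the edges of $\widetilde\tau$ with $\mathbb Z[G]^E$. Let $L:\mathbb Z[G]^E\to\mathbb Z[G]^E$ be the $\mathbb Z[G]$-linear map that sends the bottom edge $\mathbf b$ of each tetrahedron of $\widetilde\tau$ to $\mathbf b-(\mathbf t+\mathbf s_1+\mathbf s_2)$; every edge is the bottom edge of exactly one tetrahedron. Put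 $V_\tau=\det L\in\mathbb Z[G]$. Flow graph. Let $\Phi=\Phi_\tau$ be the directed graph with vertex set $E$ and, for each tetrahedron, three edges, from $\mathbf b$ to $\mathbf t$, $\mathbf s_1$ and $\mathbf s_2$. It embeds in $M$: a vertex goes to a point of the corresponding edge of $\tau$, and an edge goes to a segment, inside its tetrahedron or a bottom face of it, from $\mathbf b$ to $\mathbf t$ or $\mathbf s_i$. Let $i_*:\mathbb Z[H_1(\Phi)]\to\mathbb Z[G]$ be induced by this inclusion. Let $A$ be the matrix over $\mathbb Z[C_1(\Phi)]$ whose $(a,b)$ entry is the sum of the edges of $\Phi$ from $a$ to $b$, where $C_1(\Phi)$ is the group of simplicial $1$-chains. Then $P_\Phi=\det(I-A)$ lies in $\mathbb Z[H_1(\Phi)]\subset\mathbb Z[C_1(\Phi)]$, and, for every choice of lifts, \[ V_\tau = i_*(P_\Phi) = 1+\sum_{\sigma}(-1)^{|\sigma|}\, i_*(\sigma), \] where $\sigma$ runs over the nonempty finite sets of pairwise (vertex-)disjoint directed simple cycles of $\Phi$, $|\sigma|$ is the number of cycles in $\sigma$, and $i_*(\sigma)\in G\subset\mathbb Z[G]$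 is the image of the sum in $H_1(\Phi)$ of the cycles in $\sigma$. -/

import Mathlib

noncomputable section

namespace Veering

open CategoryTheory AlgebraicTopology

/-! ## First singular homology: classes of paths and loops -/

section SingularHomology

open Simplicial

variable (X : Type) [TopologicalSpace X]

/-- The singular chain complex of `X` with integer coefficients. -/
abbrev singularChains : ChainComplex (ModuleCat.{0} ℤ) ℕ :=
  (TopCat.toSSet.obj (TopCat.of X)).chainComplex (ModuleCat.of ℤ ℤ)

/-- `H₁(X; ℤ)`, singular homology. -/
abbrev H1 : Type :=
  ((singularHomologyFunctor (ModuleCat.{0} ℤ) 1).obj (ModuleCat.of ℤ ℤ)).obj (TopCat.of X)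

/-- `H₁(X; ℤ)` modulo torsion. -/
abbrev FreeH1 : Type := H1 X ⧸ Submodule.torsion ℤ (H1 X)

variable {X}

/-- The singular `0`-simplex at a point. -/
def pointSimplex (x : X) : (TopCat.toSSet.obj (TopCat.of X)) _⦋0⦌ :=
  TopCat.toSSetObj₀Equiv.symm x

/-- A path regarded as a singular `1`-simplex, running from vertex `0` to vertex `1`. -/
def pathSimplex {x y : X} (γ : Path x y) : (TopCat.toSSet.obj (TopCat.of X)) _⦋1⦌ :=
  ((TopCat.of X).toSSetObjEquiv _).symm
    (γ.toContinuousMap.comp (stdSimplexHomeomorphUnitInterval : C(stdSimplex ℝ (Fin 2), unitInterval)))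

theorem delta_zero_pathSimplex {x y : X} (γ : Path x y) :
    (TopCat.toSSet.obj (TopCat.of X)).δ 0 (pathSimplex γ) = pointSimplex y := by
  apply TopCat.toSSetObj₀Equiv.injective
  rw [pointSimplex, Equiv.apply_symm_apply]
  change γ (stdSimplexHomeomorphUnitInterval (stdSimplex.map (Fin.succAbove 0) default)) = y
  rw [Subsingleton.elim (default : stdSimplex ℝ (Fin 1)) (stdSimplex.vertex 0), stdSimplex.map_vertex]
  exact γ.target

theorem delta_one_pathSimplex {x y : X} (γ : Path x y) :
    (TopCat.toSSet.obj (TopCat.of X)).δ 1 (pathSimplex γ) = pointSimplex x := by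
  apply TopCat.toSSetObj₀Equiv.injective
  rw [pointSimplex, Equiv.apply_symm_apply]
  change γ (stdSimplexHomeomorphUnitInterval (stdSimplex.map (Fin.succAbove 1) default)) = x
  rw [Subsingleton.elim (default : stdSimplex ℝ (Fin 1)) (stdSimplex.vertex 0), stdSimplex.map_vertex]
  exact γ.source

/-- The morphism `ℤ ⟶ C₁(X)` picking out the singular `1`-simplex of a path. -/
def pathChain {x y : X} (γ : Path x y) : ModuleCat.of ℤ ℤ ⟶ (singularChains X).X 1 :=
  (TopCat.toSSet.obj (TopCat.of X)).ιChainComplex (pathSimplex γ)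

/-- The morphism `ℤ ⟶ C₀(X)` picking out the singular `0`-simplex of a point. -/
def pointChain (x : X) : ModuleCat.of ℤ ℤ ⟶ (singularChains X).X 0 :=
  (TopCat.toSSet.obj (TopCat.of X)).ιChainComplex (pointSimplex x)

theorem pathChain_d {x y : X} (γ : Path x y) :
    pathChain γ ≫ (singularChains X).d 1 0 = pointChain y - pointChain x := by
  rw [pathChain, SSet.ιChainComplex_d]
  simp [Fin.sum_univ_two, delta_zero_pathSimplex, delta_one_pathSimplex, pointChain, sub_eq_add_neg]

/-- The homology class of a family of `1`-cycles `k : A ⟶ C₁(X)`. -/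
def homologyClass {A : ModuleCat.{0} ℤ} (k : A ⟶ (singularChains X).X 1)
    (hk : k ≫ (singularChains X).d 1 0 = 0) : A →ₗ[ℤ] H1 X :=
  ((singularChains X).liftCycles k 0 (by simp) hk ≫ (singularChains X).homologyπ 1).hom

/-- The class in `H₁(X; ℤ)` of a loop. -/
def loopClass {x : X} (γ : Path x x) : H1 X :=
  homologyClass (pathChain γ) (by rw [pathChain_d, sub_self]) 1

end SingularHomology

/-! ## Finite directed graphs (loops and multiple edges allowed) -/

/-- A directed multigraph with vertex set `V` and edge set `E`. -/
structure DiGraph (V E : Type) where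
  src : E → V
  tgt : E → V

namespace DiGraph

variable {V E : Type} (D : DiGraph V E)

/-- The simplicial boundary map `C₁(D) → C₀(D)`, sending an edge to target minus source. -/
def boundary : (E →₀ ℤ) →ₗ[ℤ] (V →₀ ℤ) :=
  Finsupp.lmapDomain ℤ ℤ D.tgt - Finsupp.lmapDomain ℤ ℤ D.src

/-- `H₁(D)`: the group of simplicial `1`-cycles of `D`, a subgroup of `C₁(D)`. -/
abbrev H1 : Type := LinearMap.ker D.boundary

section Perron

variable [Fintype V] [Fintype E]

open Classical in
/-- The adjacency matrix of `D` over `ℤ[C₁(D)]`: the `(a, b)` entry is the sum of all edges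
from `a` to `b`. -/
def adjMatrix : Matrix V V (AddMonoidAlgebra ℤ (E →₀ ℤ)) :=
  Matrix.of fun a b => ∑ e with D.src e = a ∧ D.tgt e = b,
    AddMonoidAlgebra.single (Finsupp.single e 1) 1

open Classical in
/-- `det (I - A)` as an element of `ℤ[C₁(D)]`. -/
def perronDet : AddMonoidAlgebra ℤ (E →₀ ℤ) := (1 - D.adjMatrix).det

/-- The ring inclusion `ℤ[H₁(D)] → ℤ[C₁(D)]`. -/
def cycleInclusion : AddMonoidAlgebra ℤ D.H1 →+* AddMonoidAlgebra ℤ (E →₀ ℤ) :=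
  AddMonoidAlgebra.mapDomainRingHom ℤ (LinearMap.ker D.boundary).subtype.toAddMonoidHom

/-- The Perron polynomial of `D` as an element of `ℤ[H₁(D)]`: the coefficient of a cycle `z` is
its coefficient in `det (I - A)`. (That `det (I - A)` is supported on cycles, so that nothing is
discarded here, amounts to `D.cycleInclusion D.perronPolynomial = D.perronDet`.) -/
def perronPolynomial : AddMonoidAlgebra ℤ D.H1 :=
  AddMonoidAlgebra.ofCoeff
    (D.perronDet.coeff.comapDomain Subtype.val Subtype.val_injective.injOn)

end Perron

/-- A directed simple cycle of `D`: a nonempty cyclic sequence of edges, each ending where the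
next one starts, that visits no vertex twice. -/
def IsSimpleCycle (c : Cycle E) : Prop :=
  c ≠ Cycle.nil ∧ c.Chain (fun e f => D.tgt e = D.src f) ∧ (c.map D.src).Nodup

/-- The directed simple cycles of `D` (up to cyclic rotation). -/
abbrev SimpleCycle : Type := {c : Cycle E // D.IsSimpleCycle c}

/-- The vertices that a cycle visits. -/
def cycleVertices (c : Cycle E) : Set V := {v | v ∈ c.map D.src}

theorem cycleVertices_nonempty (c : D.SimpleCycle) : (D.cycleVertices c.1).Nonempty := by
  obtain ⟨c, hc, -, -⟩ := c
  induction c using Cycle.induction_on with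
  | nil => exact absurd rfl hc
  | cons a l _ => exact ⟨D.src a, by simp [cycleVertices]⟩

/-- The cycle complex of `D`: its vertices are the directed simple cycles of `D`, and two of them
are joined by an edge when they are disjoint. -/
def cycleComplex : SimpleGraph D.SimpleCycle where
  Adj c c' := Disjoint (D.cycleVertices c.1) (D.cycleVertices c'.1)
  symm := ⟨fun _ _ h => h.symm⟩
  loopless := ⟨fun c h => (D.cycleVertices_nonempty c).ne_empty (disjoint_self.1 h)⟩

/-- The `1`-chain of a cyclic sequence of edges. -/
def cycleChain (c : Cycle E) : E →₀ ℤ := (c.toMultiset.map fun e => Finsupp.single e 1).sum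

theorem boundary_list {l : List E} {a b : E}
    (h : List.IsChain (fun e f => D.tgt e = D.src f) (a :: (l ++ [b]))) :
    D.boundary (((a :: l).map fun e => Finsupp.single e 1).sum) =
      Finsupp.single (D.src b) 1 - Finsupp.single (D.src a) 1 := by
  induction l generalizing a with
  | nil => simp_all [boundary]
  | cons c l ih =>
    rw [List.cons_append, List.isChain_cons_cons] at h
    have := ih h.2
    rw [List.map_cons, List.sum_cons, map_add, this]
    simp [boundary, h.1]

theorem cycleChain_mem (c : D.SimpleCycle) : cycleChain c.1 ∈ LinearMap.ker D.boundary := by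
  obtain ⟨c, -, hc, -⟩ := c
  rw [LinearMap.mem_ker]
  induction c using Cycle.induction_on with
  | nil => simp [cycleChain]
  | cons a l _ =>
    rw [Cycle.chain_coe_cons] at hc
    simpa [cycleChain] using D.boundary_list hc

/-- The class in `H₁(D)` of a directed simple cycle. -/
def cycleClass (c : D.SimpleCycle) : D.H1 := ⟨cycleChain c.1, D.cycleChain_mem c⟩

/-- The class in `H₁(D)` of a set of directed simple cycles: the sum of the classes. -/
def cliqueClass (σ : Finset D.SimpleCycle) : D.H1 := ∑ c ∈ σ, D.cycleClass c

instance [Finite E] : Finite D.SimpleCycle := by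
  classical
  have := Fintype.ofFinite E
  refine Finite.of_injective (β := {s : Cycle E // s.Nodup}) (fun c => ⟨c.1, ?_⟩) ?_
  · obtain ⟨c, -, -, hc⟩ := c
    induction c using Cycle.induction_on with
    | nil => exact Cycle.nodup_nil
    | cons a l _ => exact List.Nodup.of_map D.src (by simpa using hc)
  · intro c d h
    exact Subtype.ext (Subtype.mk.inj h)

instance [Finite E] : Fintype D.SimpleCycle := Fintype.ofFinite _

open Classical in
/-- The nonempty cliques of the cycle complex: nonempty sets of pairwise disjoint directed simple
cycles. -/
def cliques [Finite E] : Finset (Finset D.SimpleCycle) :=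
  {σ | σ.Nonempty ∧ D.cycleComplex.IsClique (σ : Set D.SimpleCycle)}

theorem d_arcs {X : Type} [TopologicalSpace X] (pos : V → X)
    (arc : ∀ e, Path (pos (D.src e)) (pos (D.tgt e))) :
    ((singularChains X).d 1 0).hom ∘ₗ
        (Finsupp.linearCombination ℤ fun e => (pathChain (arc e)).hom (1 : ℤ)) =
      (Finsupp.linearCombination ℤ fun v => (pointChain (pos v)).hom (1 : ℤ)) ∘ₗ D.boundary := by
  ext e
  have h := congrArg (fun f => f.hom (1 : ℤ)) (pathChain_d (arc e))
  simp only [boundary, LinearMap.comp_apply, Finsupp.lsingle_apply, LinearMap.sub_apply,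
    Finsupp.lmapDomain_apply, Finsupp.mapDomain_single, map_sub,
    Finsupp.linearCombination_single]
  erw [one_smul, one_smul, one_smul]
  exact h

/-- The homomorphism `H₁(D) → H₁(X)` induced by mapping `D` to a space `X`, the vertex `v` to the
point `pos v` and the edge `e` along the path `arc e`: an integral combination of edges that is a
cycle goes to the class of the same combination of the singular simplices `arc e`. -/
def inducedH1 {X : Type} [TopologicalSpace X] (pos : V → X)
    (arc : ∀ e, Path (pos (D.src e)) (pos (D.tgt e))) : D.H1 →ₗ[ℤ] Veering.H1 X :=
  homologyClass
    (ModuleCat.ofHom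
      ((Finsupp.linearCombination ℤ fun e => (pathChain (arc e)).hom (1 : ℤ)) ∘ₗ
        (LinearMap.ker D.boundary).subtype))
    (by
      ext z
      have h := LinearMap.congr_fun (D.d_arcs pos arc) z.1
      rw [LinearMap.comp_apply, LinearMap.comp_apply, LinearMap.mem_ker.1 z.2, map_zero] at h
      exact h)

end DiGraph

/-! ## Ideal, taut and veering triangulations -/

/-- The standard ideal tetrahedron: a tetrahedron minus its vertices, in barycentric
coordinates. -/
def idealTet : Set (Fin 4 → ℝ) := {x | x ∈ stdSimplex ℝ (Fin 4) ∧ ∀ i, x i < 1}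

theorem convex_idealTet : Convex ℝ idealTet := by
  have h : idealTet = stdSimplex ℝ (Fin 4) ∩ ⋂ i, {x : Fin 4 → ℝ | x i < 1} := by
    ext x; simp [idealTet]
  rw [h]
  exact (convex_stdSimplex ℝ (Fin 4)).inter
    (convex_iInter fun i => convex_halfSpace_lt (LinearMap.proj (R := ℝ) i).isLinear 1)

/-- An edge of a tetrahedron with vertices `0, 1, 2, 3`, given by its two endpoints. -/
abbrev TetEdge : Type := {s : Finset (Fin 4) // s.card = 2}

/-- The midpoint of an edge of the ideal tetrahedron. -/
def TetEdge.mid (s : TetEdge) : idealTet :=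
  ⟨fun i => if i ∈ s.1 then 1 / 2 else 0, by
    refine ⟨⟨fun i => ?_, ?_⟩, fun i => ?_⟩
    · beta_reduce; split_ifs <;> norm_num
    · rw [Finset.sum_ite_mem, Finset.univ_inter, Finset.sum_const, s.2]; norm_num
    · beta_reduce; split_ifs <;> norm_num⟩

/-- The image of an edge under a relabelling of the vertices. -/
def TetEdge.map (π : Equiv.Perm (Fin 4)) (s : TetEdge) : TetEdge :=
  ⟨s.1.map π.toEmbedding, by rw [Finset.card_map]; exact s.2⟩

/-- The straight path between two points of the ideal tetrahedron. -/
def segmentPath (x y : idealTet) : Path x y where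
  toFun u := ⟨AffineMap.lineMap x.1 y.1 (u : ℝ),
    convex_idealTet.lineMap_mem x.2 y.2 u.2⟩
  continuous_toFun := by
    refine Continuous.subtype_mk ?_ _
    simp only [AffineMap.lineMap_apply_module]
    fun_prop
  source' := by simp
  target' := by simp

/-- An oriented ideal triangulation with set of tetrahedra `T`. The vertices of every tetrahedron
are `0, 1, 2, 3`, in the order that makes it positively oriented (like the tetrahedron
`v₀ v₁ v₂ v₃` in `ℝ³` with `det (v₁ - v₀, v₂ - v₀, v₃ - v₀) > 0`); the face `i` is the one opposite
to the vertex `i`. The face `i` of `t` is glued to the face `glue t i i` of `nbr t i`, each vertex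
`j ≠ i` of it going to the vertex `glue t i j`. Gluings reverse the orientation of faces, so that
the quotient is oriented: with positively oriented labels this says that `glue t i` is odd. -/
structure IdealTriangulation (T : Type) where
  nbr : T → Fin 4 → T
  glue : T → Fin 4 → Equiv.Perm (Fin 4)
  nbr_nbr : ∀ t i, nbr (nbr t i) (glue t i i) = t
  glue_nbr : ∀ t i, glue (nbr t i) (glue t i i) = (glue t i)⁻¹
  not_self_glued : ∀ t i, ¬ (nbr t i = t ∧ glue t i i = i)
  sign_glue : ∀ t i, Equiv.Perm.sign (glue t i) = -1

namespace IdealTriangulation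

variable {T : Type} (τ : IdealTriangulation T)

/-- The gluing of points of the disjoint union of the ideal tetrahedra. -/
def PointRel (p q : Σ _ : T, idealTet) : Prop :=
  ∃ i, p.2.1 i = 0 ∧ q.1 = τ.nbr p.1 i ∧ ∀ j, q.2.1 (τ.glue p.1 i j) = p.2.1 j

/-- The triangulated space `M`: the disjoint union of the ideal tetrahedra, with their faces
identified by the gluings. -/
def Space : Type := Quot τ.PointRel

instance : TopologicalSpace τ.Space :=
  inferInstanceAs (TopologicalSpace (Quot τ.PointRel))

/-- The characteristic map of the tetrahedron `t`. -/
def charMap (t : T) : C(idealTet, τ.Space) :=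
  ⟨fun x => Quot.mk _ ⟨t, x⟩, continuous_quot_mk.comp continuous_sigmaMk⟩

/-- The gluing of edges of the individual tetrahedra. -/
def EdgeRel (c d : T × TetEdge) : Prop :=
  ∃ i, i ∉ c.2.1 ∧ d = (τ.nbr c.1 i, c.2.map (τ.glue c.1 i))

/-- The set of edges of the triangulation. -/
def Edge : Type := Quot τ.EdgeRel

instance [Finite T] : Finite τ.Edge := inferInstanceAs (Finite (Quot τ.EdgeRel))

instance [Finite T] : Fintype τ.Edge := Fintype.ofFinite _

/-- The edge of the triangulation that the edge `s` of the tetrahedron `t` becomes. -/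
def edge (t : T) (s : TetEdge) : τ.Edge := Quot.mk _ (t, s)

/-- The midpoint of an edge of the triangulation. -/
def midpoint : τ.Edge → τ.Space :=
  Quot.lift (fun c => τ.charMap c.1 c.2.mid) (by
    rintro ⟨t, s⟩ _ ⟨i, hi, rfl⟩
    refine Quot.sound ⟨i, ?_, rfl, fun j => ?_⟩
    · simp [TetEdge.mid, hi]
    · simp [TetEdge.mid, TetEdge.map])

end IdealTriangulation

/-- A (transverse) taut ideal triangulation: every face is cooriented, compatibly with the
gluings, such that two faces of every tetrahedron point out of it (its top faces) and two point
into it (its bottom faces), and such that the angle sum around every edge is `2π`, where the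
bottom edge and the top edge of every tetrahedron have angle `π` and its other edges angle `0`. -/
structure TautTriangulation (T : Type) extends IdealTriangulation T where
  topFaces : T → Finset (Fin 4)
  card_topFaces : ∀ t, (topFaces t).card = 2
  coorientation : ∀ t i, i ∈ topFaces t ↔ glue t i i ∉ topFaces (nbr t i)
  angle_sum : ∀ e : toIdealTriangulation.Edge,
    Set.ncard {c : (T × TetEdge) | toIdealTriangulation.edge c.1 c.2 = e ∧
      (c.2.1 = topFaces c.1 ∨ c.2.1 = Finset.univ \ topFaces c.1)} = 2

namespace TautTriangulation

variable {T : Type} (τ : TautTriangulation T)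

/-- The bottom edge of a tetrahedron: the common edge of its two bottom faces, that is, the edge
joining the two vertices that are opposite to the top faces. -/
def bottomEdge (t : T) : TetEdge := ⟨τ.topFaces t, τ.card_topFaces t⟩

/-- The top edge of a tetrahedron: the common edge of its two top faces, that is, the edge
joining the two vertices that are opposite to the bottom faces. -/
def topEdge (t : T) : TetEdge :=
  ⟨Finset.univ \ τ.topFaces t, by
    rw [Finset.card_sdiff_of_subset (Finset.subset_univ _), τ.card_topFaces t]; rfl⟩

end TautTriangulation

inductive Veer
  | right
  | left

/-- A (transverse) veering triangulation: a taut ideal triangulation whose edges are labelled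
right or left veering such that every tetrahedron is isomorphic, by an orientation preserving
isomorphism, to the model veering tetrahedron. The model is a thickened rhombus in `ℝ² × ℝ` with
vertices `W = (-1, 0)`, `E = (1, 0)`, `N = (0, 1)`, `S = (0, -1)`, whose vertical diagonal `NS`
(the top edge) lies above its horizontal diagonal `WE` (the bottom edge); the side edges of
positive slope, `WN` and `ES`, are right veering, those of negative slope, `WS` and `EN`, are left
veering. The order `W, E, N, S` is positively oriented, so the isomorphisms are the labellings
`π` of `W, E, N, S` by an even permutation of `0, 1, 2, 3` that have the bottom edge at `WE`. -/
structure VeeringTriangulation (T : Type) extends TautTriangulation T where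
  veer : toIdealTriangulation.Edge → Veer
  model : ∀ t, ∃ π : Equiv.Perm (Fin 4), Equiv.Perm.sign π = 1 ∧
    (toTautTriangulation.bottomEdge t).1 = {π 0, π 1} ∧
    ∀ s : TetEdge,
      (s.1 = {π 0, π 2} ∨ s.1 = {π 1, π 3} →
        veer (toIdealTriangulation.edge t s) = Veer.right) ∧
      (s.1 = {π 0, π 3} ∨ s.1 = {π 1, π 2} →
        veer (toIdealTriangulation.edge t s) = Veer.left)

/-! ## The universal free abelian cover and the veering polynomial -/

/-- `p : Y → X` is the universal free abelian cover of `X`: a connected regular covering with deck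
group `G = H₁(X) / torsion`, where the deck transformation `g` is the one that carries `y` to the
end of any path starting at `y` whose projection is a loop of class `g`. -/
structure IsUniversalFreeAbelianCover {X Y : Type} [TopologicalSpace X] [TopologicalSpace Y]
    [AddAction (FreeH1 X) Y] (p : Y → X) : Prop where
  isCoveringMap : IsCoveringMap p
  surjective : Function.Surjective p
  pathConnected : PathConnectedSpace Y
  continuous_vadd : ∀ g : FreeH1 X, Continuous fun y : Y => g +ᵥ y
  map_vadd : ∀ (g : FreeH1 X) (y : Y), p (g +ᵥ y) = p y
  existsUnique_vadd : ∀ y y' : Y, p y = p y' → ∃! g : FreeH1 X, y' = g +ᵥ y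
  class_eq : ∀ (y : Y) (g : FreeH1 X) (γ : Path y (g +ᵥ y)),
    Submodule.Quotient.mk
      (loopClass ((γ.map isCoveringMap.continuous).cast rfl (map_vadd g y).symm)) = g

namespace VeeringTriangulation

variable {T : Type} (τ : VeeringTriangulation T)

/-- The edges of the tetrahedron `t` on the right-hand side of the tetrahedron relation
`b = t + s₁ + s₂`: the top edge of `t` and the side edges whose veer is opposite to that of the
top edge. -/
def IsTerm (t : T) (s : TetEdge) : Prop :=
  s = τ.topEdge t ∨
    (s ≠ τ.topEdge t ∧ s ≠ τ.bottomEdge t ∧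
      τ.veer (τ.edge t s) ≠ τ.veer (τ.edge t (τ.topEdge t)))

/-- The terms of all the tetrahedron relations. -/
abbrev Term : Type := {c : T × TetEdge // τ.IsTerm c.1 c.2}

instance [Finite T] : Fintype τ.Term := Fintype.ofFinite _

/-- `G = H₁(M) / torsion`. -/
abbrev G : Type := FreeH1 τ.Space

/-- A choice of a lift to `Y` of every edge of the triangulation (recorded by the lift of its
midpoint), together with the lifts of the tetrahedra that lie above the chosen edges. -/
structure Lifts {Y : Type} [TopologicalSpace Y] (p : Y → τ.Space) where
  edgeLift : τ.Edge → Y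
  p_edgeLift : ∀ e, p (edgeLift e) = τ.midpoint e
  tetLift : T → C(idealTet, Y)
  p_tetLift : ∀ t x, p (tetLift t x) = τ.charMap t x
  tetLift_bottom : ∀ t, tetLift t (τ.bottomEdge t).mid = edgeLift (τ.edge t (τ.bottomEdge t))

section VeeringPolynomial

variable {τ} {Y : Type} [TopologicalSpace Y] [AddAction τ.G Y] {p : Y → τ.Space}
  (hp : IsUniversalFreeAbelianCover p) (l : τ.Lifts p)

/-- The deck transformation `g` such that the edge `s` of the chosen lift of the tetrahedron `t`
is the translate by `g` of the chosen lift of the corresponding edge of the triangulation. -/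
def deck (t : T) (s : TetEdge) : τ.G :=
  (hp.existsUnique_vadd (l.edgeLift (τ.edge t s)) (l.tetLift t s.mid)
    (by rw [l.p_edgeLift, l.p_tetLift]; rfl)).choose

variable [Finite T]

open Classical in
/-- The matrix of the presentation `ℤ[G]^E → ℤ[G]^E` of the edge module, which maps the bottom
edge `b` of a tetrahedron to `b - (t + s₁ + s₂)`. The row of `b` holds the coefficients of the
image of `b`; every edge is the bottom edge of exactly one tetrahedron. -/
def edgeMatrix : Matrix τ.Edge τ.Edge (AddMonoidAlgebra ℤ τ.G) :=
  1 - Matrix.of fun b e =>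
    ∑ c : τ.Term with τ.edge c.1.1 (τ.bottomEdge c.1.1) = b ∧ τ.edge c.1.1 c.1.2 = e,
      AddMonoidAlgebra.single (deck hp l c.1.1 c.1.2) 1

open Classical in
/-- The veering polynomial. -/
def veeringPolynomial : AddMonoidAlgebra ℤ τ.G := (edgeMatrix hp l).det

end VeeringPolynomial

/-! ## The flow graph -/

/-- The flow graph `Φ`. Its vertices are the edges of the triangulation; for every tetrahedron,
there are three directed edges, from the bottom edge to the top edge and to the two side edges whose veer is
opposite to that of the top edge. -/
def flowGraph : DiGraph τ.Edge τ.Term where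
  src c := τ.edge c.1.1 (τ.bottomEdge c.1.1)
  tgt c := τ.edge c.1.1 c.1.2

/-- The image in `M` of an edge of the flow graph: the straight segment, within a tetrahedron or a
bottom face of it, from the midpoint of the bottom edge to the midpoint of the other edge. -/
def flowArc (c : τ.Term) :
    Path (τ.midpoint (τ.flowGraph.src c)) (τ.midpoint (τ.flowGraph.tgt c)) :=
  (segmentPath (τ.bottomEdge c.1.1).mid c.1.2.mid).map (τ.charMap c.1.1).continuous

/-- `i_* : H₁(Φ) → G`, induced by the inclusion of the flow graph in `M`. -/
def inclusionH1 : τ.flowGraph.H1 →+ τ.G :=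
  (Submodule.torsion ℤ (H1 τ.Space)).mkQ.toAddMonoidHom.comp
    (τ.flowGraph.inducedH1 τ.midpoint τ.flowArc).toAddMonoidHom

/-- `i_* : ℤ[H₁(Φ)] → ℤ[G]`. -/
def inclusionRing : AddMonoidAlgebra ℤ τ.flowGraph.H1 →+* AddMonoidAlgebra ℤ τ.G :=
  AddMonoidAlgebra.mapDomainRingHom ℤ τ.inclusionH1

end VeeringTriangulation

end Veering

end

noncomputable section

/-! ### Signs of cyclic permutations and cyclic lists as periodic orbits. -/

namespace Veering.DiGraph

/-! Both polynomials are determinants `det (1 - A)` of adjacency matrices of the flow graph. Only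
the edge weights differ: for `P_Φ` an edge weighs itself in `ℤ[C₁(Φ)]`, for `V_τ` it weighs the deck
transformation `deck` in `ℤ[G]`.

For arbitrary commuting weights, expand the determinant over permutations and then expand every
entry. A term is a permutation `π` with, at each vertex `v`, either the `1` of the diagonal or one
edge from `v` to `π v` (`IsSelection`). The chosen edges form disjoint simple cycles, and every set
of disjoint simple cycles arises exactly once. A cycle of length `n` contributes the sign
`(-1)^(n+1)` to `π` and `(-1)^n` from the entries `-w e`, hence `-1` in total. This is
`det_one_sub_weightedAdjMatrix`.

Over `ℤ[C₁(Φ)]` all monomials are then cycles, so the determinant lies in `ℤ[H₁(Φ)]`. It remains to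
see that `i_*` of a simple cycle is the sum of the `deck` of its edges (`inclusionH1_cycleClass`).
Lift the cycle arc by arc to the cover: the lift ends at the translate of its start by that sum, so
by `class_eq` the projected loop has this class. The loop is homologous to the sum of its arcs
(`pathElement_trans`). The resulting sum over cycles does not involve the lifts. -/

theorem sign_formPerm {α : Type*} [DecidableEq α] [Fintype α] {l : List α} (hl : l.Nodup)
    (h : l ≠ []) : Equiv.Perm.sign l.formPerm = (-1) ^ (l.length + 1) := by
  induction l with
  | nil => exact absurd rfl h
  | cons x l ih =>
    cases l with
    | nil => simp
    | cons y l =>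
      have hxy : x ≠ y := by
        rintro rfl
        simp at hl
      rw [List.formPerm_cons_cons, map_mul, Equiv.Perm.sign_swap hxy,
        ih (List.nodup_cons.1 hl).2 (by simp)]
      simp [pow_succ]

theorem chain_coe_iff_getElem {α : Type*} {r : α → α → Prop} (l : List α) :
    Cycle.Chain r (l : Cycle α) ↔
      ∀ (i : ℕ) (h : i < l.length),
        r l[i] (l[(i + 1) % l.length]'(Nat.mod_lt _ (by omega))) := by
  cases l with
  | nil => simp
  | cons a l =>
    rw [Cycle.chain_coe_cons, List.isChain_iff_getElem]
    simp only [List.length_cons, List.length_append, List.length_nil]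
    refine forall_congr' fun i => ⟨fun H h => ?_, fun H h => ?_⟩
    · have := H (by omega)
      rcases Nat.lt_or_ge (i + 1) (l.length + 1) with h' | h'
      · simp only [Nat.mod_eq_of_lt h']
        grind
      · obtain rfl : i = l.length := by omega
        simp only [Nat.mod_self]
        grind
    · have := H (by omega)
      rcases Nat.lt_or_ge (i + 1) (l.length + 1) with h' | h'
      · simp only [Nat.mod_eq_of_lt h'] at this
        grind
      · obtain rfl : i = l.length := by omega
        simp only [Nat.mod_self] at this
        grind

/-- A cycle without repetitions that follows a function is a periodic orbit of it. -/
theorem eq_periodicOrbit {α : Type*} {f : α → α} {c : Cycle α} (hc : c.Nodup)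
    (h : c.Chain fun x y => y = f x) {a : α} (ha : a ∈ c) :
    c = Function.periodicOrbit f a := by
  induction c using Quot.inductionOn with
  | h l =>
  obtain ⟨s, t, rfl⟩ := List.append_of_mem (Cycle.mem_coe_iff.1 ha)
  -- Rotate the cycle so that `a` comes first; entry `i` is then `f^[i] a`.
  have hrot : (Quot.mk _ (s ++ a :: t) : Cycle α) = ((a :: (t ++ s) : List α) : Cycle α) :=
    Cycle.coe_eq_coe.2 ⟨s.length, by simp⟩
  rw [hrot] at hc h ⊢
  generalize t ++ s = l at hc h
  rw [Cycle.nodup_coe_iff] at hc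
  rw [chain_coe_iff_getElem] at h
  have key : ∀ (i : ℕ) (hi : i < (a :: l).length), (a :: l)[i] = f^[i] a := by
    intro i
    induction i with
    | zero => intro _; rfl
    | succ i ih =>
      intro hi
      have := h i (by omega)
      simp only [Nat.mod_eq_of_lt hi] at this
      rw [this, ih (by omega), Function.iterate_succ_apply']
  have hper : Function.IsPeriodicPt f (a :: l).length a := by
    have := h l.length (by simp)
    simp only [List.length_cons, Nat.mod_self] at this
    rw [key l.length (by simp)] at this
    rw [Function.IsPeriodicPt, Function.IsFixedPt, List.length_cons,
      Function.iterate_succ_apply', ← this]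
    rfl
  have hmin : Function.minimalPeriod f a = (a :: l).length := by
    -- A smaller period would make a later entry equal to entry `0`, against the absence of
    -- repetitions.
    refine le_antisymm (hper.minimalPeriod_le (by simp)) (not_lt.1 fun hlt => ?_)
    have h0 := hper.minimalPeriod_pos (by simp)
    have h1 := key _ hlt
    rw [Function.iterate_minimalPeriod] at h1
    have h2 : (a :: l)[Function.minimalPeriod f a] = (a :: l)[0] := h1
    rw [hc.getElem_inj_iff] at h2
    omega
  rw [Function.periodicOrbit_def, hmin]
  congr 1
  refine List.ext_getElem (by simp) fun i h1 h2 => ?_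
  rw [key i h1, List.getElem_map, List.getElem_range]

/-! ### Disjoint simple cycles and selections of edges. -/

variable {V E : Type} (D : DiGraph V E)

theorem IsSimpleCycle.nodup {c : Cycle E} (hc : D.IsSimpleCycle c) : c.Nodup := by
  obtain ⟨-, -, hc⟩ := hc
  induction c using Quot.inductionOn with
  | h l => exact List.Nodup.of_map D.src hc

theorem IsSimpleCycle.src_injOn {c : Cycle E} (hc : D.IsSimpleCycle c) {e e' : E} (he : e ∈ c)
    (he' : e' ∈ c) (h : D.src e = D.src e') : e = e' := by
  obtain ⟨-, -, hc⟩ := hc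
  induction c using Quot.inductionOn with
  | h l => exact List.inj_on_of_nodup_map (f := D.src) hc he he' h

theorem src_mem_cycleVertices {c : Cycle E} {e : E} (he : e ∈ c) : D.src e ∈ D.cycleVertices c :=
  Cycle.mem_map.2 ⟨e, he, rfl⟩

theorem IsSimpleCycle.exists_perm [Fintype V] [DecidableEq V] {c : Cycle E}
    (hc : D.IsSimpleCycle c) :
    ∃ π : Equiv.Perm V, Equiv.Perm.sign π = (-1) ^ (c.length + 1) ∧
      (∀ e ∈ c, π (D.src e) = D.tgt e) ∧ ∀ v ∉ D.cycleVertices c, π v = v := by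
  obtain ⟨h0, hchain, hnd⟩ := hc
  induction c using Quot.inductionOn with
  | h l =>
  change Cycle.Chain _ (l : Cycle E) at hchain
  rw [chain_coe_iff_getElem] at hchain
  change (l.map D.src).Nodup at hnd
  refine ⟨(l.map D.src).formPerm, ?_, fun e he => ?_, fun v hv => ?_⟩
  · rw [sign_formPerm hnd, List.length_map]
    · rfl
    · simpa using fun h => h0 (congrArg Cycle.ofList h)
  · obtain ⟨i, hi, rfl⟩ := List.getElem_of_mem (Cycle.mem_coe_iff.1 he)
    have := List.formPerm_apply_getElem (l.map D.src) hnd i (by simpa using hi)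
    simp only [List.getElem_map, List.length_map] at this
    rw [this, hchain i hi]
  · exact List.formPerm_apply_of_notMem hv

/-- A set of disjoint cycles induces a permutation of the vertices. -/
theorem exists_perm_of_isClique [Fintype V] [DecidableEq V] (σ : Finset D.SimpleCycle)
    (hσ : D.cycleComplex.IsClique (σ : Set D.SimpleCycle)) :
    ∃ π : Equiv.Perm V, Equiv.Perm.sign π = ∏ c ∈ σ, (-1) ^ (c.1.length + 1) ∧
      (∀ c ∈ σ, ∀ e ∈ c.1, π (D.src e) = D.tgt e) ∧
      ∀ v, (∀ c ∈ σ, v ∉ D.cycleVertices c.1) → π v = v := by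
  classical
  induction σ using Finset.induction_on with
  | empty => exact ⟨1, by simp⟩
  | insert c σ hc ih =>
    obtain ⟨π, hs, h1, h2⟩ := ih (hσ.subset (by simp))
    obtain ⟨ρ, hρs, hρ1, hρ2⟩ := c.2.exists_perm
    have hdisj : ∀ c' ∈ σ, Disjoint (D.cycleVertices c.1) (D.cycleVertices c'.1) :=
      fun c' hc' => hσ (by simp) (by simp [hc']) (by rintro rfl; exact hc hc')
    refine ⟨ρ * π, ?_, ?_, fun v hv => ?_⟩
    · rw [map_mul, hs, hρs, Finset.prod_insert hc]
    · intro c' hc' e he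
      rw [Equiv.Perm.mul_apply]
      rcases Finset.mem_insert.1 hc' with rfl | hc'
      · rw [h2, hρ1 e he]
        exact fun c'' hc'' h =>
          Set.disjoint_left.1 (hdisj c'' hc'') (D.src_mem_cycleVertices he) h
      · rw [h1 c' hc' e he, hρ2]
        intro h
        -- The cyclic permutation of `c'` sends `D.src e` to `D.tgt e` and fixes everything off
        -- `c'`. If `D.tgt e` were off `c'`, injectivity would give `D.src e = D.tgt e`, which is on
        -- `c'`.
        have hmem : D.tgt e ∈ D.cycleVertices c'.1 := by
          have hπ := h1 c' hc' e he
          obtain ⟨π', -, h1', h2'⟩ := c'.2.exists_perm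
          by_contra hcon
          have h3 := h1' e he
          have h4 : π' (D.src e) = π' (D.tgt e) := by rw [h3, h2' _ hcon]
          exact hcon (π'.injective h4 ▸ D.src_mem_cycleVertices he)
        exact Set.disjoint_left.1 (hdisj c' hc') h hmem
    · rw [Equiv.Perm.mul_apply, h2 v fun c' hc' => hv c' (by simp [hc']), hρ2 v (hv c (by simp))]

/-- A permutation `π` of the vertices together with a choice, for some vertices `v` including all
that `π` moves, of an edge from `v` to `π v`. -/
def IsSelection (π : Equiv.Perm V) (f : V → Option E) : Prop :=
  ∀ v, (f v = none → π v = v) ∧ ∀ e, f v = some e → D.src e = v ∧ D.tgt e = π v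

variable {D}

/-- The targets of the chosen edges determine `π`, so selections can be compared through `f` alone.
-/
theorem IsSelection.perm_eq {π π' : Equiv.Perm V} {f : V → Option E} (h : D.IsSelection π f)
    (h' : D.IsSelection π' f) : π = π' := by
  ext v
  cases hv : f v with
  | none => rw [(h v).1 hv, (h' v).1 hv]
  | some e => rw [← ((h v).2 e hv).2, ← ((h' v).2 e hv).2]

/-- The edges of `f` following each other. -/
def follow (D : DiGraph V E) (f : V → Option E) (e : E) : E := (f (D.tgt e)).getD e

/-- If nothing were chosen at `D.tgt e = π (D.src e)`, then `π` would fix this vertex; by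
injectivity it would be `D.src e`, where `e` is chosen. So the default value in `follow` is never
reached from a chosen edge. -/
theorem IsSelection.follow_spec {π : Equiv.Perm V} {f : V → Option E} (h : D.IsSelection π f)
    {e : E} (he : f (D.src e) = some e) :
    f (D.tgt e) = some (D.follow f e) := by
  cases hv : f (D.tgt e) with
  | none =>
    have h1 := (h _).1 hv
    rw [((h _).2 e he).2] at h1
    rw [((h _).2 e he).2, π.injective h1, he] at hv
    cases hv
  | some e' => simp [follow, hv]

theorem IsSelection.src_follow {π : Equiv.Perm V} {f : V → Option E} (h : D.IsSelection π f)
    {e : E} (he : f (D.src e) = some e) : D.src (D.follow f e) = D.tgt e :=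
  ((h _).2 _ (h.follow_spec he)).1

theorem IsSelection.follow_iterate {π : Equiv.Perm V} {f : V → Option E} (h : D.IsSelection π f)
    {e : E} (he : f (D.src e) = some e) (n : ℕ) :
    f (D.src ((D.follow f)^[n] e)) = some ((D.follow f)^[n] e) ∧
      D.src ((D.follow f)^[n] e) = (π ^ n) (D.src e) := by
  induction n with
  | zero => simpa using he
  | succ n ih =>
    rw [Function.iterate_succ_apply', h.src_follow ih.1]
    refine ⟨h.follow_spec ih.1, ?_⟩
    rw [((h _).2 _ ih.1).2, ih.2, pow_succ', Equiv.Perm.mul_apply]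

theorem IsSelection.mem_periodicPts [Finite V] {π : Equiv.Perm V} {f : V → Option E}
    (h : D.IsSelection π f) {e : E} (he : f (D.src e) = some e) :
    e ∈ Function.periodicPts (D.follow f) := by
  -- The sources along the orbit move by `π`, so after `orderOf π` steps the source is back, and `f`
  -- chooses only one edge there.
  refine ⟨orderOf π, orderOf_pos π, ?_⟩
  have h1 := h.follow_iterate he (orderOf π)
  rw [pow_orderOf_eq_one, Equiv.Perm.one_apply] at h1
  have h2 := h1.1
  rw [h1.2, he] at h2
  exact (Option.some.inj h2).symm

theorem IsSelection.mem_periodicOrbit [Finite V] {π : Equiv.Perm V} {f : V → Option E}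
    (h : D.IsSelection π f) {e : E} (he : f (D.src e) = some e) {e' : E}
    (he' : e' ∈ Function.periodicOrbit (D.follow f) e) : f (D.src e') = some e' := by
  obtain ⟨n, rfl⟩ := (Function.mem_periodicOrbit_iff (h.mem_periodicPts he)).1 he'
  exact (h.follow_iterate he n).1

theorem IsSelection.isSimpleCycle [Finite V] {π : Equiv.Perm V} {f : V → Option E}
    (h : D.IsSelection π f) {e : E} (he : f (D.src e) = some e) :
    D.IsSimpleCycle (Function.periodicOrbit (D.follow f) e) := by
  have hper := h.mem_periodicPts he
  refine ⟨fun h0 => Function.periodicOrbit_eq_nil_iff_not_periodic_pt.1 h0 hper, ?_, ?_⟩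
  · rw [Function.periodicOrbit_chain' _ hper]
    intro n
    rw [Function.iterate_succ_apply', h.src_follow (h.follow_iterate he n).1]
  · have hnd := Function.nodup_periodicOrbit (f := D.follow f) (x := e)
    have hmem := fun e' => h.mem_periodicOrbit he (e' := e')
    generalize Function.periodicOrbit (D.follow f) e = c at hnd hmem
    induction c using Quot.inductionOn with
    | h l =>
    refine List.Nodup.map_on (fun x hx y hy hxy => ?_) hnd
    have h1 := hmem x hx
    rw [hxy, hmem y hy] at h1
    exact (Option.some.inj h1).symm

/-- A simple cycle whose edges all belong to a selection is an orbit of the selection. -/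
theorem IsSimpleCycle.eq_periodicOrbit {f : V → Option E} {c : Cycle E} (hc : D.IsSimpleCycle c)
    (hf : ∀ e ∈ c, f (D.src e) = some e) {e : E} (he : e ∈ c) :
    c = Function.periodicOrbit (D.follow f) e := by
  refine DiGraph.eq_periodicOrbit hc.nodup ?_ he
  have hch := hc.2.1
  clear hc he
  induction c using Quot.inductionOn with
  | h l =>
  change Cycle.Chain _ (l : Cycle E) at hch
  change Cycle.Chain _ (l : Cycle E)
  rw [chain_coe_iff_getElem] at hch ⊢
  intro i hi
  have h1 := hch i hi
  rw [follow, h1, hf _ (Cycle.mem_coe_iff.2 (List.getElem_mem _))]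
  rfl

/-- Disjointness forces the cycles to agree, and a simple cycle leaves each of its vertices only
once. Hence a clique has at most one edge out of each vertex. -/
theorem IsClique.eq_of_src_eq {σ : Finset D.SimpleCycle}
    (hσ : D.cycleComplex.IsClique (σ : Set D.SimpleCycle)) {c c' : D.SimpleCycle} (hc : c ∈ σ)
    (hc' : c' ∈ σ) {e e' : E} (he : e ∈ c.1) (he' : e' ∈ c'.1) (h : D.src e = D.src e') :
    c = c' ∧ e = e' := by
  have hcc : c = c' := by
    by_contra hne
    exact Set.disjoint_left.1 (hσ hc hc' hne) (D.src_mem_cycleVertices he)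
      (h ▸ D.src_mem_cycleVertices he')
  subst hcc
  exact ⟨rfl, c.2.src_injOn _ he he' h⟩

/-- Sets of disjoint simple cycles correspond to selections. -/
theorem exists_isSelection [Fintype V] [DecidableEq V] {σ : Finset D.SimpleCycle}
    (hσ : D.cycleComplex.IsClique (σ : Set D.SimpleCycle)) :
    ∃ p : Equiv.Perm V × (V → Option E), D.IsSelection p.1 p.2 ∧
      Equiv.Perm.sign p.1 = ∏ c ∈ σ, (-1) ^ (c.1.length + 1) ∧
      ∀ v e, p.2 v = some e ↔ D.src e = v ∧ ∃ c ∈ σ, e ∈ c.1 := by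
  classical
  obtain ⟨π, hs, h1, h2⟩ := D.exists_perm_of_isClique σ hσ
  -- The edge of `σ` out of `v`, unique by `IsClique.eq_of_src_eq`, and `none` off the cycles of
  -- `σ`.
  let f : V → Option E := fun v =>
    if h : ∃ e, D.src e = v ∧ ∃ c ∈ σ, e ∈ c.1 then some h.choose else none
  have hf : ∀ v e, f v = some e ↔ D.src e = v ∧ ∃ c ∈ σ, e ∈ c.1 := by
    intro v e
    constructor
    · intro h
      by_cases hv : ∃ e, D.src e = v ∧ ∃ c ∈ σ, e ∈ c.1
      · simp only [f, dif_pos hv] at h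
        rw [← Option.some.inj h]
        exact hv.choose_spec
      · simp only [f, dif_neg hv] at h
        cases h
    · rintro ⟨rfl, c, hc, he⟩
      have hv : ∃ e', D.src e' = D.src e ∧ ∃ c ∈ σ, e' ∈ c.1 := ⟨e, rfl, c, hc, he⟩
      simp only [f, dif_pos hv]
      obtain ⟨h3, c', hc', h4⟩ := hv.choose_spec
      rw [(IsClique.eq_of_src_eq hσ hc' hc h4 he h3).2]
  refine ⟨(π, f), fun v => ⟨fun hv => h2 v fun c hc hmem => ?_, fun e he => ?_⟩, hs, hf⟩
  · obtain ⟨e, he, rfl⟩ := Cycle.mem_map.1 hmem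
    have := (hf (D.src e) e).2 ⟨rfl, c, hc, he⟩
    exact absurd (hv.symm.trans this) (by simp)
  · obtain ⟨rfl, c, hc, he⟩ := (hf v e).1 he
    exact ⟨rfl, (h1 c hc e he).symm⟩

/-! ### Expansion of the determinant for arbitrary edge weights. -/

variable (D)

/-- The adjacency matrix of a digraph whose edges have weights. -/
def weightedAdjMatrix [Fintype E] [DecidableEq V] {R : Type*} [CommRing R] (w : E → R) :
    Matrix V V R :=
  Matrix.of fun a b => ∑ e with D.src e = a ∧ D.tgt e = b, w e

/-- The weight of a cycle. -/
def cycleWeight {R : Type*} [CommRing R] (w : E → R) (c : Cycle E) : R :=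
  (c.toMultiset.map w).prod

variable [Fintype V] [DecidableEq V] {R : Type*} [CommRing R] (w : E → R)

open Classical in
-- Vertices off the cycles contribute `1`; the remaining factors regroup by cycle, where the signs
-- combine to one `-1` per cycle.
theorem selection_term {σ : Finset D.SimpleCycle}
    (hσ : D.cycleComplex.IsClique (σ : Set D.SimpleCycle)) {π : Equiv.Perm V} {f : V → Option E}
    (hs : Equiv.Perm.sign π = ∏ c ∈ σ, (-1) ^ (c.1.length + 1))
    (hf : ∀ v e, f v = some e ↔ D.src e = v ∧ ∃ c ∈ σ, e ∈ c.1) :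
    ((Equiv.Perm.sign π : ℤ) : R) * ∏ v, (f v).elim 1 (fun e => - w e) =
      (-1) ^ σ.card * ∏ c ∈ σ, cycleWeight w c.1 := by
  let F : Finset E := σ.biUnion fun c => c.1.toMultiset.toFinset
  have hF : ∀ e, e ∈ F ↔ ∃ c ∈ σ, e ∈ c.1 := by
    intro e
    simp only [F, Finset.mem_biUnion, Multiset.mem_toFinset]
    refine exists_congr fun c => and_congr_right fun _ => ?_
    obtain ⟨c, hc⟩ := c
    induction c using Quot.inductionOn with
    | h l => exact Iff.rfl
  have h1 : ∏ v, (f v).elim 1 (fun e => - w e) = ∏ e ∈ F, - w e := by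
    have hsub : ∏ v ∈ F.image D.src, (f v).elim 1 (fun e => - w e) =
        ∏ v, (f v).elim 1 (fun e => - w e) := by
      refine Finset.prod_subset (Finset.subset_univ _) fun v _ hv => ?_
      cases hfv : f v with
      | none => rfl
      | some e =>
        obtain ⟨rfl, h⟩ := (hf v e).1 hfv
        exact absurd (Finset.mem_image_of_mem _ ((hF e).2 h)) hv
    rw [← hsub, Finset.prod_image]
    · refine Finset.prod_congr rfl fun e he => ?_
      rw [(hf _ e).2 ⟨rfl, (hF e).1 he⟩]
      rfl
    · intro e he e' he' h
      obtain ⟨c, hc, hce⟩ := (hF e).1 he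
      obtain ⟨c', hc', hce'⟩ := (hF e').1 he'
      exact (IsClique.eq_of_src_eq hσ hc hc' hce hce' h).2
  have h2 : ∏ e ∈ F, - w e = ∏ c ∈ σ, (-1) ^ c.1.length * cycleWeight w c.1 := by
    rw [Finset.prod_biUnion]
    · refine Finset.prod_congr rfl fun c _ => ?_
      have hnd := c.2.nodup
      generalize c.1 = c at hnd
      induction c using Quot.inductionOn with
      | h l =>
        change l.Nodup at hnd
        change ∏ e ∈ l.toFinset, - w e = (-1) ^ l.length * (l.map w).prod
        rw [List.prod_toFinset _ hnd]
        clear hnd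
        induction l with
        | nil => simp
        | cons a l ih =>
          rw [List.map_cons, List.prod_cons, ih, List.map_cons, List.prod_cons, List.length_cons]
          ring
    · intro c hc c' hc' hne
      rw [Function.onFun, Finset.disjoint_left]
      intro e he he'
      refine hne ?_
      have aux : ∀ d : Cycle E, e ∈ d.toMultiset.toFinset → e ∈ d := by
        intro d
        induction d using Quot.inductionOn with
        | h l => exact fun h => by simpa using Multiset.mem_toFinset.1 h
      exact (IsClique.eq_of_src_eq hσ hc hc' (aux _ he) (aux _ he') rfl).1
  rw [h1, h2, hs]
  push_cast
  -- Compare cycle by cycle: `(-1)^(n+1) * (-1)^n = -1` for a cycle of length `n`.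
  rw [← Finset.prod_mul_distrib, ← Finset.prod_const, ← Finset.prod_mul_distrib]
  refine Finset.prod_congr rfl fun c _ => ?_
  rw [pow_succ, mul_neg_one, neg_mul, ← mul_assoc, ← mul_pow]
  simp

variable [Fintype E]

open Classical in
-- The Leibniz formula, with each product of entries multiplied out into choices at the vertices.
theorem det_one_sub_eq_sum_selections :
    (1 - D.weightedAdjMatrix w).det =
      ∑ p : Equiv.Perm V × (V → Option E) with D.IsSelection p.1 p.2,
        (Equiv.Perm.sign p.1 : ℤ) * ∏ v, (p.2 v).elim 1 fun e => - w e := by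
  -- `none` stands for the `1` of the identity matrix. At a fixed vertex it competes with the loops,
  -- so `π` alone does not determine the choice.
  have entry : ∀ a b : V, (1 - D.weightedAdjMatrix w) a b =
      ∑ x : Option E with (x = none → b = a) ∧ ∀ e, x = some e → D.src e = a ∧ D.tgt e = b,
        x.elim 1 fun e => - w e := by
    intro a b
    rw [Finset.sum_filter, Fintype.sum_option]
    simp only [weightedAdjMatrix, Matrix.sub_apply, Matrix.one_apply, Matrix.of_apply]
    rw [sub_eq_add_neg, ← Finset.sum_neg_distrib, Finset.sum_filter]
    congr 1
    · simp [eq_comm]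
    · simp
  -- `Matrix.det_apply'` uses the entries `(π v, v)`; transposing turns them into `(v, π v)`, the
  -- direction of the edges.
  rw [← Matrix.det_transpose, Matrix.det_apply', Finset.sum_filter, Fintype.sum_prod_type]
  refine Finset.sum_congr rfl fun π _ => ?_
  simp only [Matrix.transpose_apply, entry]
  rw [Finset.prod_univ_sum, Finset.mul_sum, ← Finset.sum_filter]
  refine Finset.sum_congr ?_ fun _ _ => rfl
  ext f
  simp only [Fintype.mem_piFinset, Finset.mem_filter, Finset.mem_univ, true_and]
  rfl

open Classical in
/-- Expansion of `det (1 - A)` over the sets of disjoint simple cycles. -/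
theorem det_one_sub_weightedAdjMatrix :
    (1 - D.weightedAdjMatrix w).det =
      1 + ∑ σ ∈ D.cliques, (-1) ^ σ.card * ∏ c ∈ σ, cycleWeight w c.1 := by
  -- The leading `1` is the term of the empty clique.
  have hins : (Finset.univ.filter fun σ : Finset D.SimpleCycle =>
      D.cycleComplex.IsClique (σ : Set D.SimpleCycle)) = insert ∅ D.cliques := by
    ext σ
    rcases σ.eq_empty_or_nonempty with rfl | hσ
    · simp
    · simp [cliques, hσ, hσ.ne_empty]
  have h0 : ∅ ∉ D.cliques := by simp [cliques]
  have key : ∑ σ ∈ insert ∅ D.cliques, (-1) ^ σ.card * ∏ c ∈ σ, cycleWeight w c.1 =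
      1 + ∑ σ ∈ D.cliques, (-1) ^ σ.card * ∏ c ∈ σ, cycleWeight w c.1 := by
    rw [Finset.sum_insert h0]
    simp
  rw [← key, ← hins, det_one_sub_eq_sum_selections]
  symm
  have hcl : ∀ {σ}, σ ∈ Finset.univ.filter (fun σ : Finset D.SimpleCycle =>
      D.cycleComplex.IsClique (σ : Set D.SimpleCycle)) →
      D.cycleComplex.IsClique (σ : Set D.SimpleCycle) := fun h => (Finset.mem_filter.1 h).2
  refine Finset.sum_bij (fun σ hσ => (exists_isSelection (hcl hσ)).choose) ?_ ?_ ?_ ?_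
  · intro σ hσ
    exact Finset.mem_filter.2 ⟨Finset.mem_univ _, (exists_isSelection (hcl hσ)).choose_spec.1⟩
  -- Injectivity: `σ` consists of the simple cycles all of whose edges are chosen. Such a cycle is
  -- the `follow` orbit of any of its edges, so it coincides with the cycle of `σ` through that
  -- edge.
  · have recover : ∀ {σ : Finset D.SimpleCycle} (hσ : D.cycleComplex.IsClique (σ : Set D.SimpleCycle)) (c : D.SimpleCycle),
        c ∈ σ ↔ ∀ e ∈ c.1, (exists_isSelection hσ).choose.2 (D.src e) = some e := by
      intro σ hσ c
      obtain ⟨h1, -, h2⟩ := (exists_isSelection hσ).choose_spec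
      refine ⟨fun hc e he => (h2 _ _).2 ⟨rfl, c, hc, he⟩, fun h => ?_⟩
      obtain ⟨v, hv⟩ := D.cycleVertices_nonempty c
      obtain ⟨e, he, rfl⟩ := Cycle.mem_map.1 hv
      obtain ⟨-, c', hc', he'⟩ := (h2 _ _).1 (h e he)
      have hcc : c = c' := Subtype.ext ((c.2.eq_periodicOrbit h he).trans
        (c'.2.eq_periodicOrbit (fun x hx => (h2 _ _).2 ⟨rfl, c', hc', hx⟩) he').symm)
      exact hcc ▸ hc'
    intro σ hσ σ' hσ' h
    ext c
    rw [recover (hcl hσ), recover (hcl hσ')]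
    have h' := congrArg Prod.snd h

    rw [h']
  · rintro ⟨π, f⟩ hp
    have hp : D.IsSelection π f := (Finset.mem_filter.1 hp).2
    -- Surjectivity: the preimage is the set of all simple cycles made of chosen edges, and each
    -- chosen edge lies on its own `follow` orbit.
    let σ : Finset D.SimpleCycle := Finset.univ.filter fun c => ∀ e ∈ c.1, f (D.src e) = some e
    have hmem : ∀ {c}, c ∈ σ ↔ ∀ e ∈ c.1, f (D.src e) = some e := by simp [σ]
    have hσ : D.cycleComplex.IsClique (σ : Set D.SimpleCycle) := by
      intro c hc c' hc' hne
      have hc := hmem.1 (Finset.mem_coe.1 hc)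
      have hc' := hmem.1 (Finset.mem_coe.1 hc')
      refine Set.disjoint_left.2 fun v hv hv' => hne ?_
      obtain ⟨e, he, rfl⟩ := Cycle.mem_map.1 hv
      obtain ⟨e', he', h⟩ := Cycle.mem_map.1 hv'
      have h3 := hc' e' he'
      rw [h, hc e he] at h3
      obtain rfl := Option.some.inj h3
      exact Subtype.ext ((c.2.eq_periodicOrbit hc he).trans
        (c'.2.eq_periodicOrbit hc' he').symm)
    have hσ' : σ ∈ Finset.univ.filter (fun σ : Finset D.SimpleCycle =>
        D.cycleComplex.IsClique (σ : Set D.SimpleCycle)) :=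
      Finset.mem_filter.2 ⟨Finset.mem_univ _, hσ⟩
    refine ⟨σ, hσ', ?_⟩
    obtain ⟨h1, -, h2⟩ := (exists_isSelection (hcl hσ')).choose_spec
    have hf : (exists_isSelection (hcl hσ')).choose.2 = f := by
      funext v
      refine Option.ext fun e => ?_
      rw [h2]
      constructor
      · rintro ⟨rfl, c, hc, he⟩
        exact hmem.1 hc e he
      · intro h
        obtain ⟨rfl, -⟩ := (hp v).2 e h
        exact ⟨rfl, ⟨_, hp.isSimpleCycle h⟩, hmem.2 fun x hx => hp.mem_periodicOrbit h hx,
          Function.self_mem_periodicOrbit (hp.mem_periodicPts h)⟩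
    rw [hf] at h1
    exact Prod.ext (h1.perm_eq hp) hf
  · intro σ hσ
    obtain ⟨-, h1, h2⟩ := (exists_isSelection (hcl hσ)).choose_spec
    exact (D.selection_term w (hcl hσ) h1 h2).symm

end Veering.DiGraph


namespace Veering

open CategoryTheory AlgebraicTopology Simplicial

/-! ### Singular `1`-chains of paths modulo boundaries. -/

section Concatenation

variable {X : Type} [TopologicalSpace X]

theorem homologyClass_comp {A B : ModuleCat.{0} ℤ} (α : A ⟶ B) (k : B ⟶ (singularChains X).X 1)
    (hk : k ≫ (singularChains X).d 1 0 = 0) (a : A) :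
    homologyClass (α ≫ k) (by rw [Category.assoc, hk, Limits.comp_zero]) a =
      homologyClass k hk (α.hom a) := by
  rw [homologyClass, homologyClass, ← HomologicalComplex.comp_liftCycles (hk := hk)]
  rfl

theorem homologyClass_congr {A : ModuleCat.{0} ℤ} (k k' : A ⟶ (singularChains X).X 1)
    (hk : k ≫ (singularChains X).d 1 0 = 0) (hk' : k' ≫ (singularChains X).d 1 0 = 0)
    (b : A ⟶ (singularChains X).X 2) (h : k - k' = b ≫ (singularChains X).d 2 1) :
    homologyClass k hk = homologyClass k' hk' := by
  have h1 := (singularChains X).liftCycles_homologyπ_eq_zero_of_boundary (k - k') 0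
    (by simp) b h
  have h2 : (singularChains X).liftCycles (k - k') 0 (by simp)
      (by rw [Preadditive.sub_comp, hk, hk', sub_zero]) =
      (singularChains X).liftCycles k 0 (by simp) hk -
        (singularChains X).liftCycles k' 0 (by simp) hk' := by
    rw [← cancel_mono ((singularChains X).iCycles 1)]
    simp
  rw [h2, Preadditive.sub_comp, sub_eq_zero] at h1
  rw [homologyClass, homologyClass, h1]

/-- Homologous cycles have the same class. -/
theorem homologyClass_eq {A B : ModuleCat.{0} ℤ} (k : A ⟶ (singularChains X).X 1)
    (k' : B ⟶ (singularChains X).X 1)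
    (hk : k ≫ (singularChains X).d 1 0 = 0) (hk' : k' ≫ (singularChains X).d 1 0 = 0)
    (a : A) (a' : B)
    (h : k.hom a - k'.hom a' ∈ LinearMap.range ((singularChains X).d 2 1).hom) :
    homologyClass k hk a = homologyClass k' hk' a' := by
  obtain ⟨b, hb⟩ := h
  -- Elements are replaced by morphisms from `ℤ`, to which `homologyClass_congr` applies.
  let α : ModuleCat.of ℤ ℤ ⟶ A := ModuleCat.ofHom (LinearMap.toSpanSingleton ℤ A a)
  let α' : ModuleCat.of ℤ ℤ ⟶ B := ModuleCat.ofHom (LinearMap.toSpanSingleton ℤ B a')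
  let β : ModuleCat.of ℤ ℤ ⟶ (singularChains X).X 2 :=
    ModuleCat.ofHom (LinearMap.toSpanSingleton ℤ _ b)
  have h1 := homologyClass_comp α k hk (1 : ℤ)
  have h2 := homologyClass_comp α' k' hk' (1 : ℤ)
  have ha : α.hom (1 : ℤ) = a := LinearMap.toSpanSingleton_apply_one ℤ _ a
  have ha' : α'.hom (1 : ℤ) = a' := LinearMap.toSpanSingleton_apply_one ℤ _ a'
  have hβ : β.hom (1 : ℤ) = b := LinearMap.toSpanSingleton_apply_one ℤ _ b
  rw [ha] at h1
  rw [ha'] at h2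
  rw [← h1, ← h2, homologyClass_congr _ _ _ _ β]
  ext
  change k.hom (α.hom (1 : ℤ)) - k'.hom (α'.hom (1 : ℤ)) =
    ((singularChains X).d 2 1).hom (β.hom (1 : ℤ))
  rw [ha, ha', hβ, hb]

/-- The map from the triangle to the interval with `v₀ ↦ 0`, `v₁ ↦ 1 / 2`, `v₂ ↦ 1`. -/
def triangleFold : C(stdSimplex ℝ (Fin 3), unitInterval) where
  toFun x := ⟨x.1 1 / 2 + x.1 2, by
    have h0 := x.2.1 0
    have h1 := x.2.1 1
    have h2 := x.2.1 2
    have h3 := x.2.2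
    rw [Fin.sum_univ_three] at h3
    constructor <;> linarith⟩
  continuous_toFun := by
    refine Continuous.subtype_mk ?_ _
    have h : ∀ i : Fin 3, Continuous fun x : stdSimplex ℝ (Fin 3) => x.1 i :=
      fun i => (continuous_apply i).comp continuous_subtype_val
    exact ((h 1).div_const 2).add (h 2)

theorem triangleFold_map (f : Fin 2 → Fin 3) (x : stdSimplex ℝ (Fin 2)) :
    (triangleFold (stdSimplex.map f x) : ℝ) =
      (∑ i with f i = 1, x.1 i) / 2 + ∑ i with f i = 2, x.1 i := by
  change (stdSimplex.map f x) 1 / 2 + (stdSimplex.map f x) 2 = _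
  rw [stdSimplex.map_coe, FunOnFinite.linearMap_apply_apply, FunOnFinite.linearMap_apply_apply]
  rfl

/-- The singular triangle witnessing the concatenation of two paths. -/
def transSimplex {x y z : X} (γ : Path x y) (δ : Path y z) :
    (TopCat.toSSet.obj (TopCat.of X)) _⦋2⦌ :=
  ((TopCat.of X).toSSetObjEquiv _).symm ((γ.trans δ).toContinuousMap.comp triangleFold)

theorem delta_transSimplex {x y z : X} (γ : Path x y) (δ : Path y z) (i : Fin 3)
    {a b : X} (ε : Path a b)
    (h : ∀ s : stdSimplex ℝ (Fin 2), (γ.trans δ) (triangleFold (stdSimplex.map i.succAbove s)) =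
      ε (stdSimplexHomeomorphUnitInterval s)) :
    (TopCat.toSSet.obj (TopCat.of X)).δ i (transSimplex γ δ) = pathSimplex ε := by
  apply ((TopCat.of X).toSSetObjEquiv _).injective
  rw [pathSimplex, Equiv.apply_symm_apply]
  ext s
  exact h s

theorem coe_stdSimplexHomeomorphUnitInterval (s : stdSimplex ℝ (Fin 2)) :
    (stdSimplexHomeomorphUnitInterval s : ℝ) = s.1 1 := rfl

/-- The face `v₁v₂` folds onto `[1/2, 1]`, where the concatenation runs through its second half.
Likewise `v₀v₂` folds onto the whole interval and `v₀v₁` onto `[0, 1/2]`, which gives the other two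
faces. -/
theorem delta_zero_transSimplex {x y z : X} (γ : Path x y) (δ : Path y z) :
    (TopCat.toSSet.obj (TopCat.of X)).δ 0 (transSimplex γ δ) = pathSimplex δ := by
  refine delta_transSimplex _ _ _ _ fun s => ?_
  have h1 := s.2.1 1
  have hs := s.2.2
  rw [Fin.sum_univ_two] at hs
  have h := triangleFold_map (Fin.succAbove 0) s
  rw [show (Finset.univ.filter fun i : Fin 2 => Fin.succAbove (0 : Fin 3) i = 1) = {0} by decide,
    show (Finset.univ.filter fun i : Fin 2 => Fin.succAbove (0 : Fin 3) i = 2) = {1} by decide,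
    Finset.sum_singleton, Finset.sum_singleton] at h
  rw [← Path.extend_extends', ← Path.extend_extends' δ, coe_stdSimplexHomeomorphUnitInterval, h,
    Path.extend_trans_of_half_le _ _ (by linarith)]
  congr 1
  linarith

theorem delta_one_transSimplex {x y z : X} (γ : Path x y) (δ : Path y z) :
    (TopCat.toSSet.obj (TopCat.of X)).δ 1 (transSimplex γ δ) = pathSimplex (γ.trans δ) := by
  refine delta_transSimplex _ _ _ _ fun s => ?_
  have h := triangleFold_map (Fin.succAbove 1) s
  rw [show (Finset.univ.filter fun i : Fin 2 => Fin.succAbove (1 : Fin 3) i = 1) = ∅ by decide,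
    show (Finset.univ.filter fun i : Fin 2 => Fin.succAbove (1 : Fin 3) i = 2) = {1} by decide,
    Finset.sum_singleton, Finset.sum_empty, zero_div, zero_add] at h
  rw [← Path.extend_extends', ← Path.extend_extends' (γ.trans δ),
    coe_stdSimplexHomeomorphUnitInterval, h]

theorem delta_two_transSimplex {x y z : X} (γ : Path x y) (δ : Path y z) :
    (TopCat.toSSet.obj (TopCat.of X)).δ 2 (transSimplex γ δ) = pathSimplex γ := by
  refine delta_transSimplex _ _ _ _ fun s => ?_
  have h0 := s.2.1 0
  have hs := s.2.2
  rw [Fin.sum_univ_two] at hs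
  have h := triangleFold_map (Fin.succAbove 2) s
  rw [show (Finset.univ.filter fun i : Fin 2 => Fin.succAbove (2 : Fin 3) i = 1) = {1} by decide,
    show (Finset.univ.filter fun i : Fin 2 => Fin.succAbove (2 : Fin 3) i = 2) = ∅ by decide,
    Finset.sum_singleton, Finset.sum_empty, add_zero] at h
  rw [← Path.extend_extends', ← Path.extend_extends' γ, coe_stdSimplexHomeomorphUnitInterval, h,
    Path.extend_trans_of_le_half _ _ (by linarith)]
  congr 1
  linarith

/-- The group of `1`-boundaries. -/
abbrev boundaries (X : Type) [TopologicalSpace X] : Submodule ℤ ((singularChains X).X 1) :=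
  LinearMap.range ((singularChains X).d 2 1).hom

/-- The singular `1`-chain of a path. -/
def pathElement {x y : X} (γ : Path x y) : (singularChains X).X 1 := (pathChain γ).hom (1 : ℤ)

/-- The boundary of `transSimplex γ δ` is `δ - γδ + γ`, the negative of the difference in question.
-/
theorem pathElement_trans {x y z : X} (γ : Path x y) (δ : Path y z) :
    pathElement (γ.trans δ) - (pathElement γ + pathElement δ) ∈ boundaries X := by
  let κ : ModuleCat.of ℤ ℤ ⟶ (singularChains X).X 2 :=
    (TopCat.toSSet.obj (TopCat.of X)).ιChainComplex (transSimplex γ δ)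
  have h : κ ≫ (singularChains X).d 2 1 =
      pathChain δ - pathChain (γ.trans δ) + pathChain γ := by
    refine (SSet.ιChainComplex_d _ _ (transSimplex γ δ)).trans ?_
    rw [Fin.sum_univ_three, delta_zero_transSimplex, delta_one_transSimplex,
      delta_two_transSimplex]
    simp [pathChain, sub_eq_add_neg]
  have h2 : ((singularChains X).d 2 1).hom (κ.hom (1 : ℤ)) =
      pathElement δ - pathElement (γ.trans δ) + pathElement γ :=
    congrArg (fun f => f.hom (1 : ℤ)) h
  refine neg_mem_iff.1 ⟨_, h2.trans ?_⟩
  abel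

theorem loopClass_eq {A : ModuleCat.{0} ℤ} {x : X} (γ : Path x x)
    (k : A ⟶ (singularChains X).X 1) (hk : k ≫ (singularChains X).d 1 0 = 0) (a : A)
    (h : pathElement γ - k.hom a ∈ boundaries X) : loopClass γ = homologyClass k hk a :=
  homologyClass_eq _ _ _ _ _ _ h

end Concatenation

/-! ### Lifting walks of the flow graph to the free abelian cover. -/

namespace VeeringTriangulation

variable {T : Type} {τ : VeeringTriangulation T} {Y : Type} [TopologicalSpace Y]
  [AddAction τ.G Y] {p : Y → τ.Space} (hp : IsUniversalFreeAbelianCover p) (l : τ.Lifts p)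

theorem tetLift_mid (t : T) (s : TetEdge) :
    l.tetLift t s.mid = deck hp l t s +ᵥ l.edgeLift (τ.edge t s) :=
  (hp.existsUnique_vadd (l.edgeLift (τ.edge t s)) (l.tetLift t s.mid)
    (by rw [l.p_edgeLift, l.p_tetLift]; rfl)).choose_spec.1

/-- The lift of an arc of the flow graph that starts at the chosen lift of its source. -/
def liftedArc (c : τ.Term) :
    Path (l.edgeLift (τ.flowGraph.src c))
      (deck hp l c.1.1 c.1.2 +ᵥ l.edgeLift (τ.flowGraph.tgt c)) :=
  ((segmentPath (τ.bottomEdge c.1.1).mid c.1.2.mid).map (l.tetLift c.1.1).continuous).cast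
    (l.tetLift_bottom c.1.1).symm (tetLift_mid hp l c.1.1 c.1.2).symm

/-- The singular simplex depends only on the underlying map, so casts of endpoints can be ignored.
-/
theorem pathElement_eq {X : Type} [TopologicalSpace X] {x y x' y' : X} (γ : Path x y)
    (δ : Path x' y') (h : ∀ u, γ u = δ u) : pathElement γ = pathElement δ := by
  have h' : γ.toContinuousMap = δ.toContinuousMap := ContinuousMap.ext h
  rw [pathElement, pathElement, pathChain, pathChain, pathSimplex, pathSimplex, h']

theorem pathElement_map_liftedArc (c : τ.Term) :
    pathElement ((liftedArc hp l c).map hp.isCoveringMap.continuous) =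
      pathElement (τ.flowArc c) :=
  pathElement_eq _ _ fun _ => l.p_tetLift _ _

/-- A walk in the flow graph lifts to a path, whose end is translated by the sum of the deck
transformations along the walk. -/
theorem exists_lifted_walk (cs : List τ.Term) (a b : τ.Term)
    (h : List.IsChain (fun e f => τ.flowGraph.tgt e = τ.flowGraph.src f) (a :: (cs ++ [b]))) :
    ∃ (y : Y) (γ : Path (l.edgeLift (τ.flowGraph.src a)) y),
      y = ((a :: cs).map fun c => deck hp l c.1.1 c.1.2).sum +ᵥ
        l.edgeLift (τ.flowGraph.src b) ∧
      pathElement (γ.map hp.isCoveringMap.continuous) -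
        ((a :: cs).map fun c => pathElement (τ.flowArc c)).sum ∈ boundaries τ.Space := by
  induction cs generalizing a with
  | nil =>
    have hab : τ.flowGraph.tgt a = τ.flowGraph.src b := by simpa using h
    refine ⟨_, liftedArc hp l a, ?_, ?_⟩
    · rw [hab, List.map_singleton, List.sum_singleton]
    · rw [pathElement_map_liftedArc, List.map_singleton, List.sum_singleton, sub_self]
      exact zero_mem _
  | cons c cs ih =>
    rw [List.cons_append, List.isChain_cons_cons] at h
    obtain ⟨y, γ, hy, hγ⟩ := ih c h.2
    -- The first arc ends at a translate of the chosen lift of its target, so the lift of the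
    -- remaining walk is translated by the same deck transformation. This does not change its
    -- projection.
    let δ : Path (deck hp l a.1.1 a.1.2 +ᵥ l.edgeLift (τ.flowGraph.tgt a))
        (deck hp l a.1.1 a.1.2 +ᵥ y) :=
      (γ.map (hp.continuous_vadd (deck hp l a.1.1 a.1.2))).cast (by rw [h.1]) rfl
    refine ⟨_, (liftedArc hp l a).trans δ, ?_, ?_⟩
    · rw [List.map_cons, List.sum_cons, add_vadd, ← hy]
    have h1 := pathElement_trans ((liftedArc hp l a).map hp.isCoveringMap.continuous)
      (δ.map hp.isCoveringMap.continuous)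
    have h2 : pathElement (δ.map hp.isCoveringMap.continuous) =
        pathElement (γ.map hp.isCoveringMap.continuous) :=
      pathElement_eq _ _ fun u => hp.map_vadd _ _
    rw [← Path.map_trans, pathElement_map_liftedArc, h2] at h1
    have h3 := add_mem h1 hγ
    rw [List.map_cons (l := c :: cs), List.sum_cons]
    convert h3 using 1
    abel

/-- The class in `G` of a directed simple cycle is the sum of the deck transformations of its
edges. -/
theorem inclusionH1_cycleClass (c : τ.flowGraph.SimpleCycle) :
    τ.inclusionH1 (τ.flowGraph.cycleClass c) =
      (c.1.toMultiset.map fun c => deck hp l c.1.1 c.1.2).sum := by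
  obtain ⟨c, hc⟩ := c
  have hchain := hc.2.1
  have hne := hc.1
  obtain ⟨s, rfl⟩ : ∃ s : List τ.Term, c = (s : Cycle τ.Term) :=
    ⟨_, (Quot.out_eq c).symm⟩
  cases s with
  | nil => exact absurd rfl hne
  | cons a cs =>
  rw [Cycle.chain_coe_cons] at hchain
  -- The last edge of the chain only marks the endpoint. With `a` in that place the walk closes up,
  -- and `γ` runs from a point to a translate of it, as `class_eq` requires.
  obtain ⟨_, γ, rfl, hγ⟩ := exists_lifted_walk hp l cs a a hchain
  have h1 := hp.class_eq _ _ γ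
  change _ = ((a :: cs).map fun c => deck hp l c.1.1 c.1.2).sum
  rw [← h1]
  change Submodule.Quotient.mk (τ.flowGraph.inducedH1 τ.midpoint τ.flowArc _) = _
  congr 1
  refine (loopClass_eq _ _ _ _ ?_).symm
  have hsum : Finsupp.linearCombination ℤ (fun e => pathElement (τ.flowArc e))
      (((a :: cs).map fun e => Finsupp.single e (1 : ℤ)).sum) =
      ((a :: cs).map fun c => pathElement (τ.flowArc c)).sum := by
    rw [map_list_sum, List.map_map]
    congr 1
    refine List.map_congr_left fun e _ => ?_
    rw [Function.comp_apply, Finsupp.linearCombination_single]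
    erw [one_smul]
  exact Eq.mp (congrArg₂ (fun x y => x - y ∈ boundaries τ.Space)
    (pathElement_eq _ _ fun _ => rfl) hsum.symm) hγ

end VeeringTriangulation

end Veering

namespace Veering

/-! ### Specialization to the group rings and comparison. -/

namespace DiGraph
variable {V E : Type} (D : DiGraph V E)

theorem cycleWeight_single {M : Type*} [AddCommMonoid M] (m : E → M) (c : Cycle E) :
    cycleWeight (fun e => AddMonoidAlgebra.single (m e) (1 : ℤ)) c =
      AddMonoidAlgebra.single (c.toMultiset.map m).sum 1 := by
  induction c using Quot.inductionOn with
  | h l =>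
  change (l.map _).prod = AddMonoidAlgebra.single (l.map m).sum 1
  induction l with
  | nil => rfl
  | cons a l ih => simp [ih, AddMonoidAlgebra.single_mul_single]

theorem prod_cycleWeight_single {M : Type*} [AddCommMonoid M] (m : E → M)
    (σ : Finset D.SimpleCycle) :
    ∏ c ∈ σ, cycleWeight (fun e => AddMonoidAlgebra.single (m e) (1 : ℤ)) c.1 =
      AddMonoidAlgebra.single (∑ c ∈ σ, (c.1.toMultiset.map m).sum) 1 := by
  classical
  induction σ using Finset.induction_on with
  | empty => rfl
  | insert c σ hc ih =>
    rw [Finset.prod_insert hc, Finset.sum_insert hc, ih, cycleWeight_single,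
      AddMonoidAlgebra.single_mul_single, one_mul]

variable [Fintype V] [Fintype E]

/-- The sum over the sets of disjoint simple cycles, in the group ring of the first homology. -/
def cliquePolynomial : AddMonoidAlgebra ℤ D.H1 :=
  1 + ∑ σ ∈ D.cliques, (-1) ^ σ.card * AddMonoidAlgebra.single (D.cliqueClass σ) 1

/-- With every edge as its own weight, the weight of a clique is the monomial of its `1`-chain, a
cycle. This is why `det (I - A)` is supported on `H₁(D)`. -/
theorem cycleInclusion_cliquePolynomial : D.cycleInclusion D.cliquePolynomial = D.perronDet := by
  classical
  have h := D.det_one_sub_weightedAdjMatrix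
    fun e => AddMonoidAlgebra.single (Finsupp.single e (1 : ℤ)) (1 : ℤ)
  have h' : D.perronDet = (1 - D.weightedAdjMatrix
      fun e => AddMonoidAlgebra.single (Finsupp.single e (1 : ℤ)) (1 : ℤ)).det := by
    rw [perronDet, adjMatrix, weightedAdjMatrix]
  rw [h', h, cliquePolynomial, map_add, map_one, map_sum]
  congr 1
  refine Finset.sum_congr rfl fun σ _ => ?_
  rw [map_mul, map_pow, map_neg, map_one, prod_cycleWeight_single]
  congr 1
  simp [cycleInclusion, cliqueClass, cycleClass, cycleChain]

/-- Reading off the coefficients at cycles inverts the injective `cycleInclusion` on its image,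
which contains the determinant. -/
theorem perronPolynomial_eq : D.perronPolynomial = D.cliquePolynomial := by
  apply AddMonoidAlgebra.coeff_injective
  ext z
  change D.perronDet.coeff z.1 = _
  rw [← cycleInclusion_cliquePolynomial]
  exact Finsupp.mapDomain_apply Subtype.val_injective _ _

end DiGraph

namespace VeeringTriangulation

variable {T : Type} [Finite T] {τ : VeeringTriangulation T} {Y : Type} [TopologicalSpace Y]
  [AddAction τ.G Y] {p : Y → τ.Space} (hp : IsUniversalFreeAbelianCover p) (l : τ.Lifts p)

/-- The edge matrix is `1 - A` for the flow graph weighted by `deck`, and the weights along a clique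
sum to its image under `inclusionH1`. -/
theorem veeringPolynomial_eq :
    veeringPolynomial hp l = 1 + ∑ σ ∈ τ.flowGraph.cliques, (-1) ^ σ.card *
      τ.inclusionRing (AddMonoidAlgebra.single (τ.flowGraph.cliqueClass σ) 1) := by
  classical
  have h := τ.flowGraph.det_one_sub_weightedAdjMatrix
    fun c => AddMonoidAlgebra.single (deck hp l c.1.1 c.1.2) (1 : ℤ)
  have h' : veeringPolynomial hp l = (1 - τ.flowGraph.weightedAdjMatrix
      fun c => AddMonoidAlgebra.single (deck hp l c.1.1 c.1.2) (1 : ℤ)).det := by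
    rw [veeringPolynomial, edgeMatrix, DiGraph.weightedAdjMatrix]
    convert rfl <;> rfl
  rw [h', h]
  congr 1
  refine Finset.sum_congr rfl fun σ _ => ?_
  rw [DiGraph.prod_cycleWeight_single]
  congr 1
  have : τ.inclusionH1 (τ.flowGraph.cliqueClass σ) =
      ∑ c ∈ σ, (c.1.toMultiset.map fun c => deck hp l c.1.1 c.1.2).sum := by
    rw [DiGraph.cliqueClass, map_sum]
    exact Finset.sum_congr rfl fun c _ => inclusionH1_cycleClass hp l c
  rw [← this]
  exact (AddMonoidAlgebra.mapDomain_single).symm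

theorem inclusionRing_cliquePolynomial :
    τ.inclusionRing τ.flowGraph.cliquePolynomial =
      1 + ∑ σ ∈ τ.flowGraph.cliques, (-1) ^ σ.card *
        τ.inclusionRing (AddMonoidAlgebra.single (τ.flowGraph.cliqueClass σ) 1) := by
  simp [DiGraph.cliquePolynomial]

end VeeringTriangulation

end Veering

end

theorem theorem4p9 {T : Type} [Finite T] (τ : Veering.VeeringTriangulation T) [ConnectedSpace τ.Space]
    {Y : Type} [TopologicalSpace Y] [AddAction τ.G Y] {p : Y → τ.Space}
    (hp : Veering.IsUniversalFreeAbelianCover p) (l : τ.Lifts p) :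
    τ.flowGraph.cycleInclusion τ.flowGraph.perronPolynomial = τ.flowGraph.perronDet ∧
    Veering.VeeringTriangulation.veeringPolynomial hp l = τ.inclusionRing τ.flowGraph.perronPolynomial ∧
    Veering.VeeringTriangulation.veeringPolynomial hp l = 1 + ∑ σ ∈ τ.flowGraph.cliques,
      (-1) ^ σ.card * τ.inclusionRing (AddMonoidAlgebra.single (τ.flowGraph.cliqueClass σ) 1) := by
  rw [Veering.DiGraph.perronPolynomial_eq]
  refine ⟨τ.flowGraph.cycleInclusion_cliquePolynomial, ?_,
    Veering.VeeringTriangulation.veeringPolynomial_eq hp l⟩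
  rw [Veering.VeeringTriangulation.veeringPolynomial_eq,
    Veering.VeeringTriangulation.inclusionRing_cliquePolynomial]
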